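/- Let $F$ be a finite field and let $w\ge 0$, $m\ge 0$, $l\ge 1$ be integers. A linear network coding problem of rate $w$ consists of a finite acyclic directed graph $G=(V,E)$ (parallel channels allowed), a source node $s\in V$, and a set $T\subseteq V\setminus\{s\}$ of sink nodes without outgoing channels such that $w\le C_t$ for every $t\in T$, where $C_t$ is the minimum cut capacity between $s$ and $t$ (each channel having capacity $1$). The nodes in $J=V\setminus(\{s\}\cup T)$ are called internal. In random linear network coding over $F$, one adds $w$ imaginary channels entering $s$, whose global encoding kernels are the standard basis vectors of $F^w$; for every channel $e$ and every channel $d$ (imaginary or not) entering the tail of $e$, a local encoding coefficient $k_{d,e}\in F$ is chosen, all of them independently and uniformly at random, and the global encoding kernel of $e$ is the column vector $f_e=\sum_{d\in \mathrm{In}(\mathrm{tail}(e))}k_{d,e}f_d\in F^w$. The failure probability at the sink node $t\in T$ is $P_{e_t}=\Pr(\operatorname{rank}(F_t)<w)$, where $F_t=(f_e: e\in \mathrm{In}(t))$. Then the maximum of $P_{e_t}$ over all linear network coding problems of rate $w$ with $|J|=m$ internal nodes and $|T|=l$ sink nodes, and over all sink nodes $t\in T$ of such a problem, exists and is $$P_{e_t}^*(m,l)=1-\left[\prod_{i=1}^{w}\left(1-\frac{1}{|F|^i}\right)\right]^{m+1}.$$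 -/

import Mathlib

open MeasureTheory

/-- A communication network: a finite acyclic directed graph, parallel channels allowed.
`V` is the set of nodes, `E` the set of channels. -/
structure Network where
  V : Type
  E : Type
  [fintypeV : Fintype V]
  [fintypeE : Fintype E]
  tail : E → V
  head : E → V
  /-- no node can be reached from itself along one or more channels -/
  acyclic : ∀ v, ¬ Relation.TransGen (fun a b => ∃ e, tail e = a ∧ head e = b) v v

attribute [instance] Network.fintypeV Network.fintypeE

namespace Network

/-- The capacity of the cut `(U, Uᶜ)`: the number of channels that leave `U`. -/
noncomputable def cutCapacity (G : Network) (U : Set G.V) : ℕ :=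
  {e : G.E | G.tail e ∈ U ∧ G.head e ∉ U}.ncard

/-- The minimum cut capacity between two distinct nodes `s` and `t`. -/
noncomputable def minCut (G : Network) (s t : G.V) : ℕ :=
  sInf {c | ∃ U : Set G.V, s ∈ U ∧ t ∉ U ∧ G.cutCapacity U = c}

/-- `d` feeds `e`: the head of `d` is the tail of `e`. -/
def Feeds (G : Network) (d e : G.E) : Prop := G.head d = G.tail e

theorem feeds_wf (G : Network) : WellFounded G.Feeds := by
  have key : ∀ d e, Relation.TransGen G.Feeds d e →
      Relation.TransGen (fun a b => ∃ e, G.tail e = a ∧ G.head e = b) (G.tail d) (G.tail e) := by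
    intro d e h
    induction h with
    | single h => exact .single ⟨d, rfl, h⟩
    | tail _ h ih => exact ih.tail ⟨_, rfl, h⟩
  have : Std.Irrefl (Relation.TransGen G.Feeds) := ⟨fun e h => G.acyclic _ (key e e h)⟩
  have wf : WellFounded (Relation.TransGen G.Feeds) := Finite.wellFounded_of_trans_of_irrefl _
  exact Subrelation.wf (fun h => Relation.TransGen.single h) wf

end Network

/-- A single source linear network coding problem with information rate `w`: a network, a source
node, a set of sink nodes (which only receive), and `w ≤ C_t` for every sink node `t`. -/
structure CodingProblem (w : ℕ) extends Network where
  s : V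
  T : Finset V
  source_notMem : s ∉ T
  sink_out : ∀ e, tail e ∉ T
  rate_le : ∀ t ∈ T, w ≤ toNetwork.minCut s t

namespace CodingProblem

variable {w : ℕ} (N : CodingProblem w)

open Classical in
/-- The set of internal nodes: all nodes other than the source and the sinks. -/
noncomputable def J : Finset N.V := {v | v ≠ N.s ∧ v ∉ N.T}

/-- The channels together with the `w` imaginary channels that enter the source and carry
the source symbols. -/
abbrev Channel : Type := Fin w ⊕ N.E

/-- The head of a possibly imaginary channel. -/
def chanHead : N.Channel → N.V := Sum.elim (fun _ => N.s) N.head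

/-- `In(i)`, the channels that enter the node `i` (for the source: with the imaginary ones). -/
abbrev In (i : N.V) : Type := {d : N.Channel // N.chanHead d = i}

/-- The adjacent pairs of channels `(d, e)`, `d ∈ In(tail(e))`. -/
abbrev AdjPair : Type := Σ e : N.E, N.In (N.tail e)

/-- A choice of all local encoding coefficients `k_{d,e}`. -/
abbrev Coeffs (F : Type*) : Type _ := N.AdjPair → F

noncomputable instance (i : N.V) : Fintype (N.In i) := Fintype.ofFinite _

variable {F : Type*} [Field F]

/-- The global encoding kernel `f_e`, computed by `f_e = ∑_{d ∈ In(tail e)} k_{d,e} f_d` in an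
upstream-to-downstream order, where the imaginary channels carry the standard basis vectors. -/
noncomputable def kernel (k : N.Coeffs F) : N.E → Fin w → F :=
  N.feeds_wf.fix fun e f => ∑ d : N.In (N.tail e), k ⟨e, d⟩ •
    (match d with
      | ⟨Sum.inl i, _⟩ => Pi.single i 1
      | ⟨Sum.inr d, h⟩ => f d h : Fin w → F)

/-- The global encoding kernel of a possibly imaginary channel. -/
noncomputable def chanKernel (k : N.Coeffs F) : N.Channel → Fin w → F :=
  Sum.elim (fun i => Pi.single i 1) (N.kernel k)

/-- The recursion that determines the global encoding kernels. -/
theorem kernel_eq (k : N.Coeffs F) (e : N.E) :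
    N.kernel k e = ∑ d : N.In (N.tail e), k ⟨e, d⟩ • N.chanKernel k d.1 := by
  rw [kernel, WellFounded.fix_eq]
  refine Finset.sum_congr rfl fun d _ => ?_
  rcases d with ⟨i | d, h⟩ <;> rfl

noncomputable instance (t : N.V) : Fintype {e : N.E // N.head e = t} := Fintype.ofFinite _

/-- The decoding matrix `F_t = (f_e : e ∈ In(t))` of a sink node `t`. -/
noncomputable def decodingMatrix (k : N.Coeffs F) (t : N.V) :
    Matrix (Fin w) {e : N.E // N.head e = t} F :=
  Matrix.of fun i e => N.kernel k e.1 i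

/-- The failure probability `P_{e_t} = Pr(rank F_t < w)` of random linear network coding over `F`
at the sink node `t`: the local encoding coefficients are independent and uniform on `F`. -/
noncomputable def sinkFailureProb (F : Type*) [Field F] [Fintype F] (t : N.V) : ℝ :=
  letI : MeasurableSpace F := ⊤
  letI : Fintype N.AdjPair := Fintype.ofFinite _
  (Measure.pi fun _ : N.AdjPair => (PMF.uniformOfFintype F).toMeasure).real
    {k : N.Coeffs F | (N.decodingMatrix k t).rank < w}

end CodingProblem

/-! Fix a sink `t` and an integral flow `P` of value `w` from `s` to `t`. Add the nodes other than
`t` to a set `D`, upstream first. The flow channels leaving `D` always number `w`; call `D` good if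
their kernels are independent. Initially they are the imaginary channels, finally flow channels
entering `t`, and goodness then gives full rank.

Adding `v` replaces its `r` incoming flow channels by its `r` outgoing ones. Modulo the span of the
rest of a good cut, the incoming kernels form a basis and the outgoing ones are uniformly random
combinations of it, up to a shift. So goodness survives with probability `invertibleProb q r`, at
least `invertibleProb q w` as `r ≤ w` (`card_goodCoeffs_inter`). Only the source and the internal
nodes send anything, which leaves `m + 1` such factors.

The bound is attained when `P` contains every channel that enters `t` or feeds a channel of `P`,
since good events are then nested, and when `r = w` at each of these nodes: a path of `w`-fold
channels. -/

/-! ### Integral flows of value `w` -/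

theorem Relation.ReflTransGen.eq_or_exists_last_exit {V : Type*} {r : V → V → Prop} {u v : V}
    (h : Relation.ReflTransGen r u v) :
    u = v ∨ ∃ x, r u x ∧ x ≠ u ∧ Relation.ReflTransGen (fun a b => r a b ∧ a ≠ u ∧ b ≠ u) x v := by
  induction h with
  | refl => exact .inl rfl
  | @tail y z _ hyz ih =>
    by_cases hz : z = u
    · exact .inl hz.symm
    right
    by_cases hy : y = u
    · subst hy; exact ⟨z, hyz, hz, .refl⟩
    · rcases ih with rfl | ⟨x, hx, hxu, hxy⟩
      · exact absurd rfl hy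
      · exact ⟨x, hx, hxu, hxy.tail ⟨hyz, hy, hz⟩⟩

section Flow

open Classical in
/-- The net outflow at `v` of the 0/1 flow carried by the channels in `P`. -/
noncomputable def netOut {V E : Type*} (tail head : E → V) (P : Finset E) (v : V) : ℤ :=
  ∑ e ∈ P, ((if tail e = v then 1 else 0) - (if head e = v then 1 else 0))

/-- A step in the residual graph of the 0/1 flow `P`. -/
def ResidualStep {V E : Type*} (tail head : E → V) (P : Finset E) (a b : V) : Prop :=
  ∃ e, (e ∉ P ∧ tail e = a ∧ head e = b) ∨ (e ∈ P ∧ head e = a ∧ tail e = b)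

variable {V E : Type*} {tail head : E → V}

open Classical in
-- The flipped channel has an end at `u`, so no residual step avoiding `u` is lost.
theorem exists_flow_of_residualStep {P : Finset E} {u x : V}
    (h : ResidualStep tail head P u x) :
    ∃ Q : Finset E, (∀ v, netOut tail head Q v =
        netOut tail head P v + (if u = v then 1 else 0) - (if x = v then 1 else 0)) ∧
      ∀ a b, a ≠ u → b ≠ u → ResidualStep tail head P a b → ResidualStep tail head Q a b := by
  obtain ⟨e, ⟨he, h1, h2⟩ | ⟨he, h1, h2⟩⟩ := h
  · refine ⟨insert e P, fun v => ?_, ?_⟩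
    · simp only [netOut, Finset.sum_insert he, h1, h2]; ring
    · rintro a b ha hb ⟨f, ⟨hf, h3, h4⟩ | ⟨hf, h3, h4⟩⟩
      · refine ⟨f, .inl ⟨?_, h3, h4⟩⟩
        rw [Finset.mem_insert, not_or]
        exact ⟨fun h => ha (by rw [← h3, h, h1]), hf⟩
      · exact ⟨f, .inr ⟨Finset.mem_insert_of_mem hf, h3, h4⟩⟩
  · refine ⟨P.erase e, fun v => ?_, ?_⟩
    · simp only [netOut, ← Finset.sum_erase_add _ _ he, h1, h2]; ring
    · rintro a b ha hb ⟨f, ⟨hf, h3, h4⟩ | ⟨hf, h3, h4⟩⟩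
      · exact ⟨f, .inl ⟨fun h => hf (Finset.mem_of_mem_erase h), h3, h4⟩⟩
      · refine ⟨f, .inr ⟨?_, h3, h4⟩⟩
        rw [Finset.mem_erase]
        exact ⟨fun h => ha (by rw [← h3, h, h1]), hf⟩

open Classical in
-- A walk can be cut at its last exit from `u`. The remainder avoids `u`, so it survives flipping
-- the first channel, and `u` can be removed from the allowed nodes `W`.
theorem exists_augmented_flow (W : Finset V) : ∀ (P : Finset E) (u t : V), u ∈ W →
    Relation.ReflTransGen (fun a b => ResidualStep tail head P a b ∧ a ∈ W ∧ b ∈ W) u t →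
    ∃ Q : Finset E, ∀ v, netOut tail head Q v =
      netOut tail head P v + (if u = v then 1 else 0) - (if t = v then 1 else 0) := by
  induction W using Finset.strongInduction with
  | H W ih =>
    intro P u t hu h
    rcases h.eq_or_exists_last_exit with rfl | ⟨x, ⟨hux, _, hxW⟩, hxu, hxt⟩
    · exact ⟨P, fun v => by ring⟩
    obtain ⟨Q, hQ, hres⟩ := exists_flow_of_residualStep hux
    have hxt' : Relation.ReflTransGen
        (fun a b => ResidualStep tail head Q a b ∧ a ∈ W.erase u ∧ b ∈ W.erase u) x t := by
      refine Relation.ReflTransGen.mono ?_ _ _ hxt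
      rintro a b ⟨⟨hab, haW, hbW⟩, ha, hb⟩
      exact ⟨hres a b ha hb hab, Finset.mem_erase.2 ⟨ha, haW⟩, Finset.mem_erase.2 ⟨hb, hbW⟩⟩
    obtain ⟨Q', hQ'⟩ := ih (W.erase u) (Finset.erase_ssubset hu) Q x t
      (Finset.mem_erase.2 ⟨hxu, hxW⟩) hxt'
    exact ⟨Q', fun v => by rw [hQ', hQ]; ring⟩

open Classical in
theorem sum_netOut [Fintype V] (P : Finset E) (R : Set V) :
    ∑ v with v ∈ R, netOut tail head P v =
      ∑ e ∈ P, ((if tail e ∈ R then 1 else 0) - (if head e ∈ R then 1 else 0)) := by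
  simp only [netOut]
  rw [Finset.sum_comm]
  refine Finset.sum_congr rfl fun e _ => ?_
  simp [Finset.sum_sub_distrib]

open Classical in
/-- The integral max-flow min-cut theorem for unit capacities. -/
theorem exists_flow_of_le_cut [Fintype V] [Fintype E] {s t : V} {w : ℕ}
    (hcut : ∀ U : Set V, s ∈ U → t ∉ U → w ≤ {e : E | tail e ∈ U ∧ head e ∉ U}.ncard) :
    ∃ P : Finset E, ∀ v, v ≠ t → netOut tail head P v = if s = v then (w : ℤ) else 0 := by
  suffices H : ∀ k ≤ w, ∃ P : Finset E, ∀ v, v ≠ t →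
      netOut tail head P v = if s = v then (k : ℤ) else 0 from H w le_rfl
  intro k hk
  induction k with
  | zero => exact ⟨∅, fun v _ => by simp [netOut]⟩
  | succ k ih =>
    obtain ⟨P, hP⟩ := ih (by omega)
    let R : Set V := {v | Relation.ReflTransGen (ResidualStep tail head P) s v}
    by_cases ht : t ∈ R
    · obtain ⟨Q, hQ⟩ := exists_augmented_flow Finset.univ P s t (Finset.mem_univ _)
        (Relation.ReflTransGen.mono (fun a b h => ⟨h, Finset.mem_univ _, Finset.mem_univ _⟩) _ _ ht)
      refine ⟨Q, fun v hv => ?_⟩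
      rw [hQ, hP v hv, if_neg (Ne.symm hv)]
      split_ifs <;> simp
    · exfalso
      have hs : s ∈ R := Relation.ReflTransGen.refl
      have h1 := sum_netOut (tail := tail) (head := head) P R
      have h2 : ∑ v with v ∈ R, netOut tail head P v = k := by
        rw [Finset.sum_congr rfl (g := fun v => if s = v then (k : ℤ) else 0)]
        · simp [hs]
        · intro v hv
          refine hP v ?_
          rintro rfl
          exact ht (by simpa using hv)
      -- Since `R` is closed under residual steps, all channels leaving `R` carry flow and none
      -- entering it does. The cut capacity of `R` is therefore `k < w`.
      have h3 : ∑ e ∈ P, ((if tail e ∈ R then (1 : ℤ) else 0) - (if head e ∈ R then 1 else 0)) =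
          ∑ e : E, if tail e ∈ R ∧ head e ∉ R then 1 else 0 := by
        rw [← Finset.sum_subset (Finset.subset_univ P)]
        · refine Finset.sum_congr rfl fun e he => ?_
          have : head e ∈ R → tail e ∈ R := fun h => h.tail ⟨e, .inr ⟨he, rfl, rfl⟩⟩
          by_cases h : tail e ∈ R <;> by_cases h' : head e ∈ R <;> simp_all
        · intro e _ he
          have : tail e ∈ R → head e ∈ R := fun h => h.tail ⟨e, .inl ⟨he, rfl, rfl⟩⟩
          rw [if_neg]; tauto
      have h4 := hcut R hs ht
      rw [Set.ncard_eq_toFinset_card'] at h4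
      simp only [Finset.sum_boole] at h3
      rw [h3, h2] at h1
      have h5 : ({e : E | tail e ∈ R ∧ head e ∉ R} : Set E).toFinset =
        Finset.univ.filter (fun e : E => tail e ∈ R ∧ head e ∉ R) := by ext; simp
      rw [h5] at h4
      norm_cast at h1
      omega

end Flow

/-! ### Counting lemmas and random invertible matrices -/

/-- Double counting over the translates `k + h`, `h` in the range of `g`. -/
theorem card_inter_mul_card_of_translates {Ω H : Type*} [AddGroup Ω] [Finite Ω] [Finite H]
    (g : H → Ω) (A B : Set Ω) (n : ℕ) (hA : ∀ k h, k + g h ∈ A ↔ k ∈ A)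
    (hB : ∀ k ∈ A, Nat.card {h : H // k + g h ∈ B} = n) :
    Nat.card ↥(A ∩ B) * Nat.card H = n * Nat.card A := by
  have := Fintype.ofFinite A
  -- The same pairs are counted by the shear `(k, h) ↦ (k + g h, h)` and by fibring over `k`, which
  -- lies in `A` by `hA`.
  have e1 : {p : Ω × H // p.1 + g p.2 ∈ A ∩ B} ≃ ↥(A ∩ B) × H :=
    { toFun := fun p => (⟨p.1.1 + g p.1.2, p.2⟩, p.1.2)
      invFun := fun p => ⟨(p.1.1 - g p.2, p.2), by simp⟩
      left_inv := fun p => by ext <;> simp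
      right_inv := fun p => by ext <;> simp }
  have e2 : {p : Ω × H // p.1 + g p.2 ∈ A ∩ B} ≃ Σ k : A, {h : H // k.1 + g h ∈ B} :=
    { toFun := fun p => ⟨⟨p.1.1, (hA _ _).1 p.2.1⟩, ⟨p.1.2, p.2.2⟩⟩
      invFun := fun p => ⟨(p.1.1, p.2.1), (hA _ _).2 p.1.2, p.2.2⟩
      left_inv := fun p => rfl
      right_inv := fun p => rfl }
  have := Nat.card_congr (e1.symm.trans e2)
  rw [Nat.card_prod, Nat.card_sigma] at this
  rw [this, Finset.sum_congr rfl (fun k _ => hB k.1 k.2)]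
  simp [mul_comm]

/-- Number of coefficient matrices that turn an affine family into a linearly independent one. -/
theorem card_linearIndependent_affine {F W I O : Type*} [Field F] [Fintype F] [AddCommGroup W]
    [Module F W] [Fintype I] [Finite O] (b : Module.Basis I F W) (c : O → W)
    (hcard : Nat.card O = Nat.card I) :
    Nat.card {K : O → I → F // LinearIndependent F fun e => c e + ∑ d, K e d • b d} =
      ∏ i ∈ Finset.range (Nat.card O),
        (Fintype.card F ^ Nat.card O - Fintype.card F ^ i) := by
  classical
  have : Module.Finite F W := Module.Finite.of_basis b
  have : Finite W := Module.finite_of_finite F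
  have hfr : Module.finrank F W = Nat.card O := by
    rw [Module.finrank_eq_card_basis b, hcard, Nat.card_eq_fintype_card]
  -- As `b` is a basis, every family arises from exactly one `K`, whatever the shift `c`.
  let E : (O → I → F) ≃ (O → W) :=
    (Equiv.piCongrRight fun _ => b.equivFun.symm.toEquiv).trans (Equiv.addLeft c)
  have e1 : {K : O → I → F // LinearIndependent F fun e => c e + ∑ d, K e d • b d} ≃
      {f : O → W // LinearIndependent F f} := by
    refine E.subtypeEquiv fun K => ?_
    have : E K = fun e => c e + ∑ d, K e d • b d := by
      funext e
      simp [E, Module.Basis.equivFun_symm_apply]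
    rw [this]
  let eO : O ≃ Fin (Nat.card O) := Finite.equivFin O
  have e2 : {f : O → W // LinearIndependent F f} ≃
      {f : Fin (Nat.card O) → W // LinearIndependent F f} := by
    refine (Equiv.arrowCongr eO (Equiv.refl W)).subtypeEquiv fun f => ?_
    exact (linearIndependent_equiv eO.symm (f := f)).symm
  rw [Nat.card_congr (e1.trans e2), card_linearIndependent hfr.ge, hfr,
    Finset.prod_range (fun i => Fintype.card F ^ Nat.card O - Fintype.card F ^ i)]

/-- The probability that a random `r × r` matrix over a field with `q` elements is invertible. -/
noncomputable def invertibleProb (q : ℝ) (r : ℕ) : ℝ := ∏ i ∈ Finset.Icc 1 r, (1 - 1 / q ^ i)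

theorem invertibleProb_nonneg {q : ℝ} (hq : 1 ≤ q) (r : ℕ) : 0 ≤ invertibleProb q r := by
  refine Finset.prod_nonneg fun i _ => sub_nonneg.2 ?_
  rw [one_div]
  exact inv_le_one_of_one_le₀ (one_le_pow₀ hq)

theorem invertibleProb_anti {q : ℝ} (hq : 1 ≤ q) : Antitone (invertibleProb q) := by
  refine antitone_nat_of_succ_le fun r => ?_
  rw [invertibleProb, Finset.prod_Icc_succ_top (by omega)]
  refine mul_le_of_le_one_right (invertibleProb_nonneg hq r) ?_
  have : 0 ≤ 1 / q ^ (r + 1) := by positivity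
  linarith

theorem prod_range_eq_invertibleProb_mul {q : ℕ} (hq : 1 ≤ q) (r : ℕ) :
    ((∏ i ∈ Finset.range r, (q ^ r - q ^ i) : ℕ) : ℝ) =
      invertibleProb q r * (q : ℝ) ^ (r * r) := by
  have hq' : (q : ℝ) ≠ 0 := by positivity
  have h1 : invertibleProb q r = ∏ i ∈ Finset.range r, (1 - 1 / (q : ℝ) ^ (r - i)) := by
    rw [invertibleProb, ← Finset.prod_range_reflect (fun i => 1 - 1 / (q : ℝ) ^ (r - i)),
      Finset.range_eq_Ico, Finset.prod_Ico_eq_prod_range, ← Finset.Ico_add_one_right_eq_Icc,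
      Finset.prod_Ico_eq_prod_range]
    refine Finset.prod_congr rfl fun i hi => ?_
    rw [Finset.mem_range] at hi
    congr 3
    omega
  have h2 : (q : ℝ) ^ (r * r) = ∏ i ∈ Finset.range r, (q : ℝ) ^ r := by simp [pow_mul]
  rw [h1, h2, ← Finset.prod_mul_distrib, Nat.cast_prod]
  refine Finset.prod_congr rfl fun i hi => ?_
  rw [Finset.mem_range] at hi
  rw [Nat.cast_sub (Nat.pow_le_pow_right hq hi.le)]
  push_cast
  have : (q : ℝ) ^ r = q ^ (r - i) * q ^ i := by rw [← pow_add]; congr 1; omega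
  rw [sub_mul, one_mul]
  congr 1
  rw [this]
  field_simp

/-- Independence suits the count at one node; spanning suits the comparison of different cuts. -/
theorem linearIndepOn_iff_span_eq_top {F α : Type*} [Field F] [Finite α] {w : ℕ}
    {f : α → Fin w → F} {s : Set α} (hs : s.ncard = w) :
    LinearIndepOn F f s ↔ Submodule.span F (f '' s) = ⊤ := by
  have := Fintype.ofFinite s
  have hc : Fintype.card s = Module.finrank F (Fin w → F) := by
    rw [Module.finrank_fin_fun, ← Nat.card_eq_fintype_card, Nat.card_coe_set_eq, hs]
  rw [Set.image_eq_range]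
  exact ⟨fun h => h.span_eq_top_of_card_eq_finrank' hc,
    fun h => linearIndependent_of_top_le_span_of_card_eq_finrank h.ge hc⟩

/-! ### Upstream-closed sets and the flow across them -/

namespace Network

theorem wellFounded_upstream (G : Network) :
    WellFounded (fun a b : G.V => ∃ e, G.tail e = b ∧ G.head e = a) := by
  have : Std.Irrefl (Relation.TransGen (fun a b : G.V => ∃ e, G.tail e = b ∧ G.head e = a)) := by
    refine ⟨fun v h => G.acyclic v ?_⟩
    rw [← Relation.transGen_swap]
    exact h
  have wf : WellFounded
      (Relation.TransGen (fun a b : G.V => ∃ e, G.tail e = b ∧ G.head e = a)) :=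
    Finite.wellFounded_of_trans_of_irrefl _
  exact Subrelation.wf (fun h => Relation.TransGen.single h) wf

theorem tail_ne_head (G : Network) (e : G.E) : G.tail e ≠ G.head e :=
  fun h => G.acyclic (G.head e) (.single ⟨e, h, rfl⟩)

/-- A set of nodes that contains every node upstream of one of its members. -/
def IsUpstreamClosed (G : Network) (D : Set G.V) : Prop := ∀ e, G.head e ∈ D → G.tail e ∈ D

end Network

namespace CodingProblem

variable {w : ℕ} (N : CodingProblem w) {F : Type*} [Field F]

/-- The imaginary channels and the channels in `P`. -/
def flowChannels (P : Finset N.E) : Set N.Channel := {d | ∀ e, d = Sum.inr e → e ∈ P}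

/-- The channels of the flow `P` that enter `v`. -/
def flowIn (P : Finset N.E) (v : N.V) : Set N.Channel := {d ∈ N.flowChannels P | N.chanHead d = v}

/-- The channels of the flow `P` that leave `v`. -/
def flowOut (P : Finset N.E) (v : N.V) : Set N.E := {e | e ∈ P ∧ N.tail e = v}

/-- The channels of the flow `P` that leave the node set `D`; the imaginary channels have
their tails in every `D`. -/
def flowCut (P : Finset N.E) (D : Set N.V) : Set N.Channel :=
  {d ∈ N.flowChannels P | N.chanHead d ∉ D ∧ ∀ e, d = Sum.inr e → N.tail e ∈ D}

/-- The coefficients for which the kernels of the flow channels leaving `D` are independent. -/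
def goodCoeffs (F : Type*) [Field F] (P : Finset N.E) (D : Set N.V) : Set (N.Coeffs F) :=
  {k | LinearIndepOn F (N.chanKernel k) (N.flowCut P D)}

variable {N} {P : Finset N.E} {D : Set N.V} {v : N.V}

theorem kernel_congr (hD : N.IsUpstreamClosed D) {k k' : N.Coeffs F}
    (h : ∀ e d, N.tail e ∈ D → k ⟨e, d⟩ = k' ⟨e, d⟩) (e : N.E) :
    N.tail e ∈ D → N.kernel k e = N.kernel k' e := by
  induction e using N.feeds_wf.induction with
  | _ e ih =>
    intro he
    rw [kernel_eq, kernel_eq]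
    refine Finset.sum_congr rfl fun d _ => ?_
    rw [h e d he]
    congr 1
    obtain ⟨d | d, hd⟩ := d
    · rfl
    · exact ih d hd (hD d (by change N.head d = _ at hd; rwa [hd]))

theorem chanKernel_congr (hD : N.IsUpstreamClosed D) {k k' : N.Coeffs F}
    (h : ∀ e d, N.tail e ∈ D → k ⟨e, d⟩ = k' ⟨e, d⟩) {d : N.Channel}
    (hd : ∀ e, d = Sum.inr e → N.tail e ∈ D) : N.chanKernel k d = N.chanKernel k' d := by
  obtain d | d := d
  · rfl
  · exact kernel_congr hD h d (hd d rfl)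

theorem flowIn_subset_flowCut (hD' : N.IsUpstreamClosed (insert v D)) (hv : v ∉ D) :
    N.flowIn P v ⊆ N.flowCut P D := by
  rintro d ⟨hd, rfl⟩
  refine ⟨hd, hv, ?_⟩
  rintro e rfl
  exact (hD' e (Set.mem_insert _ _)).resolve_left (N.tail_ne_head e)

/-- No channel leaving `v` ends in `D`, since `D` is upstream-closed and `v ∉ D`. -/
theorem flowCut_insert (hD : N.IsUpstreamClosed D) (hv : v ∉ D) :
    N.flowCut P (insert v D) =
      (N.flowCut P D \ N.flowIn P v) ∪ Sum.inr '' N.flowOut P v := by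
  ext d
  constructor
  · rintro ⟨hd, h1, h2⟩
    rw [Set.mem_insert_iff, not_or] at h1
    by_cases h : ∃ e, d = Sum.inr e ∧ N.tail e = v
    · obtain ⟨e, rfl, he⟩ := h
      exact .inr ⟨e, ⟨hd e rfl, he⟩, rfl⟩
    · push Not at h
      exact .inl ⟨⟨hd, h1.2, fun e he => (h2 e he).resolve_left (h e he)⟩, fun h' => h1.1 h'.2⟩
  · rintro (⟨⟨hd, h1, h2⟩, h3⟩ | ⟨e, ⟨he, rfl⟩, rfl⟩)
    · refine ⟨hd, ?_, fun e he => .inr (h2 e he)⟩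
      rintro (h | h)
      · exact h3 ⟨hd, h⟩
      · exact h1 h
    · refine ⟨?_, ?_, ?_⟩
      · rintro _ ⟨⟩; exact he
      · rintro (h | h)
        · exact N.tail_ne_head e h.symm
        · exact hv (hD e h)
      · rintro _ ⟨⟩; exact Set.mem_insert _ _

theorem disjoint_flowCut_flowOut (hv : v ∉ D) :
    Disjoint (N.flowCut P D \ N.flowIn P v) (Sum.inr '' N.flowOut P v) := by
  rw [Set.disjoint_right]
  rintro _ ⟨e, ⟨_, rfl⟩, rfl⟩ ⟨⟨_, _, h⟩, _⟩
  exact hv (h e rfl)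

theorem ncard_flowCut_insert (hD : N.IsUpstreamClosed D) (hD' : N.IsUpstreamClosed (insert v D))
    (hv : v ∉ D) (hP : (N.flowIn P v).ncard = (N.flowOut P v).ncard) :
    (N.flowCut P (insert v D)).ncard = (N.flowCut P D).ncard := by
  rw [flowCut_insert hD hv, Set.ncard_union_eq (disjoint_flowCut_flowOut hv),
    Set.ncard_image_of_injective _ Sum.inr_injective, ← hP,
    Set.ncard_sdiff_add_ncard_of_subset (flowIn_subset_flowCut hD' hv)]

/-! ### Randomness at a single node -/

open Classical in
/-- Coefficients supported on the pairs of flow channels adjacent at `v`. -/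
noncomputable def localCoeffs (P : Finset N.E) (v : N.V)
    (K : N.flowOut P v → N.flowIn P v → F) : N.Coeffs F :=
  fun p => if h : p.1 ∈ N.flowOut P v ∧ p.2.1 ∈ N.flowIn P v then K ⟨p.1, h.1⟩ ⟨p.2.1, h.2⟩ else 0

theorem add_localCoeffs_apply (hv : v ∉ D) (k : N.Coeffs F) (K : N.flowOut P v → N.flowIn P v → F)
    (e : N.E) (d) (he : N.tail e ∈ D) : (k + localCoeffs P v K) ⟨e, d⟩ = k ⟨e, d⟩ := by
  have : ¬ (e ∈ N.flowOut P v ∧ d.1 ∈ N.flowIn P v) := fun h => hv (h.1.2 ▸ he)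
  simp [localCoeffs, this]

/-- Kernels entering `v` depend only on coefficients at nodes of `D`, so a perturbation at `v` acts
linearly. Non-flow channels contribute only to the constant term. -/
theorem kernel_add_localCoeffs [Fintype (N.flowIn P v)] (hD : N.IsUpstreamClosed D)
    (hD' : N.IsUpstreamClosed (insert v D)) (hv : v ∉ D) (k : N.Coeffs F)
    (K : N.flowOut P v → N.flowIn P v → F) (e : N.flowOut P v) :
    N.kernel (k + localCoeffs P v K) e =
      N.kernel k e + ∑ d, K e d • N.chanKernel k d := by
  classical
  obtain ⟨e, he, rfl⟩ := e
  have h0 : ∀ d : N.In (N.tail e),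
      N.chanKernel (k + localCoeffs P (N.tail e) K) d.1 = N.chanKernel k d.1 := by
    rintro ⟨d, hd⟩
    refine chanKernel_congr hD (add_localCoeffs_apply hv k K) ?_
    rintro f rfl
    refine (hD' f (.inl hd)).resolve_left fun h => N.tail_ne_head f (h.trans hd.symm)
  rw [kernel_eq, kernel_eq]
  simp only [h0, Pi.add_apply, add_smul, Finset.sum_add_distrib]
  congr 1
  let j : N.flowIn P (N.tail e) → N.In (N.tail e) := fun d => ⟨d.1, d.2.2⟩
  have hj : Function.Injective j := fun a b h => Subtype.ext (congrArg (fun x => x.1) h)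
  rw [← Finset.sum_subset (Finset.subset_univ (Finset.univ.image j)),
    Finset.sum_image (fun a _ b _ h => hj h)]
  · refine Finset.sum_congr rfl fun d _ => ?_
    rw [localCoeffs, dif_pos ⟨⟨he, rfl⟩, d.2⟩]
  · intro d _ hd
    rw [localCoeffs, dif_neg, zero_smul]
    rintro ⟨_, h⟩
    exact hd (Finset.mem_image.2 ⟨⟨d.1, h⟩, Finset.mem_univ _, rfl⟩)

theorem add_localCoeffs_mem_goodCoeffs_iff (hD : N.IsUpstreamClosed D) (hv : v ∉ D)
    (k : N.Coeffs F) (K : N.flowOut P v → N.flowIn P v → F) :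
    k + localCoeffs P v K ∈ N.goodCoeffs F P D ↔ k ∈ N.goodCoeffs F P D := by
  refine linearIndepOn_congr fun d hd => ?_
  exact chanKernel_congr hD (add_localCoeffs_apply hv k K) hd.2.2

/-- Let `R` be the part of the cut that avoids `v`. Its kernels do not change, so goodness after
adding `v` means independence of the outgoing kernels modulo their span `p`. By a dimension count
the incoming kernels form a basis of the quotient, and `card_linearIndependent_affine` applies. -/
theorem card_localCoeffs_good [Fintype F] (hD : N.IsUpstreamClosed D)
    (hD' : N.IsUpstreamClosed (insert v D)) (hv : v ∉ D)
    (hP : (N.flowIn P v).ncard = (N.flowOut P v).ncard) (hw : (N.flowCut P D).ncard = w)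
    (k : N.Coeffs F) (hk : k ∈ N.goodCoeffs F P D) :
    Nat.card {K : N.flowOut P v → N.flowIn P v → F //
        k + localCoeffs P v K ∈ N.goodCoeffs F P (insert v D)} =
      ∏ i ∈ Finset.range (N.flowOut P v).ncard,
        (Fintype.card F ^ (N.flowOut P v).ncard - Fintype.card F ^ i) := by
  have := Fintype.ofFinite (N.flowIn P v)
  set R := N.flowCut P D \ N.flowIn P v with hR
  have := Fintype.ofFinite R
  have hsub := flowIn_subset_flowCut (P := P) hD' hv
  have hkR : LinearIndepOn F (N.chanKernel k) R := hk.mono Set.sdiff_subset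
  set p := Submodule.span F (N.chanKernel k '' R) with hp
  have hI : LinearIndepOn F (p.mkQ ∘ N.chanKernel k) (N.flowIn P v) := by
    rw [hkR.quotient_iff_union Set.disjoint_sdiff_left, hR, Set.sdiff_union_of_subset hsub]
    exact hk
  have hfp : Module.finrank F p = R.ncard := by
    have h := finrank_span_eq_card (R := F) hkR
    rw [← Nat.card_eq_fintype_card, Nat.card_coe_set_eq] at h
    rw [hp, Set.image_eq_range]
    exact h
  have hcard : Fintype.card (N.flowIn P v) = Module.finrank F ((Fin w → F) ⧸ p) := by
    have h1 := p.finrank_quotient_add_finrank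
    have h2 := Set.ncard_sdiff_add_ncard_of_subset hsub
    rw [← hR] at h2
    rw [Module.finrank_fin_fun, hfp] at h1
    rw [← Nat.card_eq_fintype_card, Nat.card_coe_set_eq]
    omega
  have hspan := hI.span_eq_top_of_card_eq_finrank' hcard
  let b : Module.Basis (N.flowIn P v) F ((Fin w → F) ⧸ p) := Module.Basis.mk hI hspan.ge
  have key := card_linearIndependent_affine b (fun e : N.flowOut P v => p.mkQ (N.kernel k e))
    (by rw [Nat.card_coe_set_eq, Nat.card_coe_set_eq, hP])
  rw [Nat.card_coe_set_eq] at key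
  rw [← key]
  refine Nat.card_congr (Equiv.subtypeEquivRight fun K => ?_)
  have hagree : Set.EqOn (N.chanKernel (k + localCoeffs P v K)) (N.chanKernel k) R :=
    fun d hd => chanKernel_congr hD (add_localCoeffs_apply hv k K) hd.1.2.2
  have hp' : Submodule.span F (N.chanKernel (k + localCoeffs P v K) '' R) = p := by
    rw [hagree.image_eq]
  have h1 := ((linearIndepOn_congr hagree).2 hkR).quotient_iff_union (disjoint_flowCut_flowOut hv)
  rw [hp'] at h1
  rw [goodCoeffs, Set.mem_ofPred_eq, flowCut_insert hD hv, ← h1]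
  have h2 : (fun e : N.flowOut P v => p.mkQ (N.kernel k e) + ∑ d, K e d • b d) =
      fun e : N.flowOut P v => p.mkQ (N.kernel (k + localCoeffs P v K) e) := by
    funext e
    rw [kernel_add_localCoeffs hD hD' hv]
    rw [map_add, map_sum]
    simp only [b, Module.Basis.mk_apply, map_smul, Function.comp_apply]
  rw [h2]
  constructor
  · intro h
    exact h.comp (fun e : N.flowOut P v => ⟨Sum.inr e.1, e.1, e.2, rfl⟩)
      fun e f h => Subtype.ext (Sum.inr_injective (congrArg Subtype.val h))
  · intro h
    exact LinearIndepOn.image_of_comp _ _ h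

/-- By `hcl`, every kernel of the new cut is a combination of kernels of the old one. If the new cut
spans, so does the old. -/
theorem goodCoeffs_insert_subset (hD : N.IsUpstreamClosed D)
    (hD' : N.IsUpstreamClosed (insert v D)) (hv : v ∉ D)
    (hP : (N.flowIn P v).ncard = (N.flowOut P v).ncard) (hw : (N.flowCut P D).ncard = w)
    (hcl : ∀ e ∈ P, ∀ d, N.head d = N.tail e → d ∈ P) :
    N.goodCoeffs F P (insert v D) ⊆ N.goodCoeffs F P D := by
  intro k hk
  rw [goodCoeffs, Set.mem_ofPred_eq, linearIndepOn_iff_span_eq_top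
    (by rw [ncard_flowCut_insert hD hD' hv hP, hw])] at hk
  rw [goodCoeffs, Set.mem_ofPred_eq, linearIndepOn_iff_span_eq_top hw, eq_top_iff, ← hk,
    Submodule.span_le, flowCut_insert hD hv]
  rintro _ ⟨d, hd | ⟨e, he, rfl⟩, rfl⟩
  · exact Submodule.subset_span ⟨d, hd.1, rfl⟩
  · change N.kernel k e ∈ _
    rw [kernel_eq]
    refine Submodule.sum_mem _ fun d _ => Submodule.smul_mem _ _ (Submodule.subset_span ?_)
    refine ⟨d.1, flowIn_subset_flowCut hD' hv ⟨?_, d.2.trans he.2⟩, rfl⟩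
    intro f hf
    refine hcl e he.1 f ?_
    have := d.2
    rw [hf] at this
    exact this

theorem card_goodCoeffs_inter [Fintype F] (hD : N.IsUpstreamClosed D)
    (hD' : N.IsUpstreamClosed (insert v D)) (hv : v ∉ D)
    (hP : (N.flowIn P v).ncard = (N.flowOut P v).ncard) (hw : (N.flowCut P D).ncard = w) :
    (Nat.card ↥(N.goodCoeffs F P D ∩ N.goodCoeffs F P (insert v D)) : ℝ) =
      invertibleProb (Fintype.card F) (N.flowOut P v).ncard * Nat.card (N.goodCoeffs F P D) := by
  have h := card_inter_mul_card_of_translates (localCoeffs (F := F) P v) _ _ _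
    (add_localCoeffs_mem_goodCoeffs_iff hD hv) (card_localCoeffs_good hD hD' hv hP hw)
  have hq : 0 < Fintype.card F := Fintype.card_pos
  have hc : Nat.card (N.flowOut P v → N.flowIn P v → F) =
      Fintype.card F ^ ((N.flowOut P v).ncard * (N.flowOut P v).ncard) := by
    rw [Nat.card_fun, Nat.card_fun, Nat.card_coe_set_eq, Nat.card_coe_set_eq, hP, pow_mul,
      Nat.card_eq_fintype_card]
  have h' := congrArg (Nat.cast (R := ℝ)) h
  rw [Nat.cast_mul, Nat.cast_mul, prod_range_eq_invertibleProb_mul hq, hc, Nat.cast_pow] at h'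
  have : ((Fintype.card F : ℝ) ^ ((N.flowOut P v).ncard * (N.flowOut P v).ncard)) ≠ 0 := by
    positivity
  refine mul_right_cancel₀ this (h'.trans ?_)
  ring

end CodingProblem

/-! ### From counts to failure probabilities -/

theorem pi_uniformOfFintype_real {ι F : Type*} [Fintype ι] [Fintype F] [Nonempty F]
    [MeasurableSpace F] [MeasurableSingletonClass F] (A : Set (ι → F)) :
    (Measure.pi fun _ : ι => (PMF.uniformOfFintype F).toMeasure).real A =
      (Nat.card A : ℝ) / Nat.card (ι → F) := by
  classical
  set μ := Measure.pi fun _ : ι => (PMF.uniformOfFintype F).toMeasure with hμ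
  have h1 : ∀ x, μ.real {x} = (Nat.card (ι → F) : ℝ)⁻¹ := by
    intro x
    rw [measureReal_def, hμ, Measure.pi_singleton]
    simp
  rw [← A.toFinite.coe_toFinset, ← sum_measureReal_singleton, Finset.sum_congr rfl fun x _ => h1 x,
    Finset.sum_const, nsmul_eq_mul, div_eq_mul_inv, Nat.card_coe_set_eq, Set.ncard_coe_finset]

namespace CodingProblem

variable {w : ℕ} {N : CodingProblem w} {F : Type*} [Field F] {P : Finset N.E} {t : N.V}

theorem flowCut_empty : N.flowCut P ∅ = Set.range Sum.inl := by
  ext d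
  constructor
  · rintro ⟨_, _, h⟩
    obtain i | e := d
    · exact ⟨i, rfl⟩
    · exact (h e rfl).elim
  · rintro ⟨i, rfl⟩
    exact ⟨by rintro _ ⟨⟩, id, by rintro _ ⟨⟩⟩

theorem ncard_flowCut_empty : (N.flowCut P ∅).ncard = w := by
  rw [flowCut_empty, ← Set.image_univ, Set.ncard_image_of_injective _ Sum.inl_injective]
  simp

theorem goodCoeffs_empty : N.goodCoeffs F P ∅ = Set.univ := by
  refine Set.eq_univ_of_forall fun k => ?_
  rw [goodCoeffs, Set.mem_ofPred_eq, flowCut_empty, ← Set.image_univ]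
  refine LinearIndepOn.image_of_comp _ _ (linearIndepOn_univ_iff.2 ?_)
  convert (Pi.basisFun F (Fin w)).linearIndependent
  funext i
  simp [chanKernel]

/-- Processing the nodes of `D` one after the other, upstream first. -/
theorem card_goodCoeffs_bounds [Fintype F]
    (hP : ∀ v, v ≠ t → (N.flowIn P v).ncard = (N.flowOut P v).ncard) (D : Finset N.V) :
    t ∉ D → N.IsUpstreamClosed (D : Set N.V) →
      (N.flowCut P D).ncard = w ∧ (∀ v ∈ D, (N.flowOut P v).ncard ≤ w) ∧
      (∏ v ∈ D, invertibleProb (Fintype.card F) (N.flowOut P v).ncard) * Nat.card (N.Coeffs F) ≤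
        Nat.card (N.goodCoeffs F P D) ∧
      ((∀ e ∈ P, ∀ d, N.head d = N.tail e → d ∈ P) →
        (∏ v ∈ D, invertibleProb (Fintype.card F) (N.flowOut P v).ncard) * Nat.card (N.Coeffs F) =
          Nat.card (N.goodCoeffs F P D)) := by
  classical
  have hq : (1 : ℝ) ≤ Fintype.card F := by exact_mod_cast Fintype.card_pos (α := F)
  induction D using Finset.strongInduction with
  | H D ih =>
    intro ht hD
    obtain rfl | hne := D.eq_empty_or_nonempty
    · simp only [Finset.coe_empty, ncard_flowCut_empty, goodCoeffs_empty]
      simp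
    -- A minimal `v` sends no channel into `D`, so `D.erase v` stays upstream-closed.
    obtain ⟨v, hv, hmin⟩ := N.wellFounded_upstream.has_min (D : Set N.V) hne
    have hvt : v ≠ t := fun h => ht (h ▸ hv)
    set D₀ := D.erase v with hD₀
    have hv₀ : v ∉ (D₀ : Set N.V) := by simp [hD₀]
    have hins : insert v (D₀ : Set N.V) = D := by
      rw [hD₀, ← Finset.coe_insert, Finset.insert_erase hv]
    have hD' : N.IsUpstreamClosed (insert v (D₀ : Set N.V)) := by rwa [hins]
    have hcl₀ : N.IsUpstreamClosed (D₀ : Set N.V) := by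
      intro e he
      rw [hD₀, Finset.mem_coe, Finset.mem_erase] at he ⊢
      exact ⟨fun h => hmin _ he.2 ⟨e, h, rfl⟩, hD e he.2⟩
    obtain ⟨h1, h2, h3, h4⟩ := ih D₀ (Finset.erase_ssubset hv)
      (fun h => ht (Finset.mem_of_mem_erase h)) hcl₀
    have hcard := card_goodCoeffs_inter (F := F) hcl₀ hD' hv₀ (hP v hvt) h1
    rw [hins] at hcard
    have hprod : ∏ v ∈ D, invertibleProb (Fintype.card F) (N.flowOut P v).ncard =
        invertibleProb (Fintype.card F) (N.flowOut P v).ncard *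
        ∏ v ∈ D₀, invertibleProb (Fintype.card F) (N.flowOut P v).ncard :=
      (Finset.mul_prod_erase D _ hv).symm
    refine ⟨?_, ?_, ?_, ?_⟩
    · rw [← hins, ncard_flowCut_insert hcl₀ hD' hv₀ (hP v hvt), h1]
    · intro u hu
      by_cases huv : u = v
      · subst huv
        rw [← hP u hvt]
        exact (Set.ncard_le_ncard (flowIn_subset_flowCut hD' hv₀)).trans h1.le
      · exact h2 u (Finset.mem_erase.2 ⟨huv, hu⟩)
    · rw [hprod, mul_assoc]
      -- The lower bound counts only coefficients good for both cuts; under `hcl` nothing is lost by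
      -- this.
      refine (mul_le_mul_of_nonneg_left h3 (invertibleProb_nonneg hq _)).trans ?_
      rw [← hcard]
      exact_mod_cast Nat.card_mono (Set.toFinite _) Set.inter_subset_right
    · intro hcl
      rw [hprod, mul_assoc, h4 hcl, ← hcard, Set.inter_eq_right.2]
      rw [← hins]
      exact goodCoeffs_insert_subset hcl₀ hD' hv₀ (hP v hvt) h1 hcl

theorem le_rank_decodingMatrix_iff (k : N.Coeffs F) :
    w ≤ (N.decodingMatrix k t).rank ↔
      Submodule.span F (Set.range fun e : {e : N.E // N.head e = t} => N.kernel k e) = ⊤ := by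
  rw [Matrix.rank_eq_finrank_span_cols]
  change w ≤ Module.finrank F (Submodule.span F (Set.range fun e : {e : N.E // N.head e = t} =>
    N.kernel k e)) ↔ _
  constructor
  · intro h
    refine Submodule.eq_top_of_finrank_eq (le_antisymm (Submodule.finrank_le _) ?_)
    rwa [Module.finrank_fin_fun]
  · intro h
    rw [h, finrank_top, Module.finrank_fin_fun]

/-- The cut of `{t}ᶜ` contains no imaginary channel, because those enter `s ≠ t`. -/
theorem flowCut_compl_singleton_image_subset (ht : t ∈ N.T) (k : N.Coeffs F) :
    N.chanKernel k '' N.flowCut P {t}ᶜ ⊆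
      Set.range fun e : {e : N.E // N.head e = t} => N.kernel k e := by
  rintro _ ⟨i | e, ⟨_, h, _⟩, rfl⟩
  · refine (N.source_notMem ?_).elim
    have : N.s = t := by simpa [chanHead] using h
    rwa [this]
  · exact ⟨⟨e, by simpa [chanHead] using h⟩, rfl⟩

theorem range_subset_flowCut_compl_singleton_image (hin : ∀ e, N.head e = t → e ∈ P)
    (k : N.Coeffs F) :
    (Set.range fun e : {e : N.E // N.head e = t} => N.kernel k e) ⊆
      N.chanKernel k '' N.flowCut P {t}ᶜ := by
  rintro _ ⟨⟨e, rfl⟩, rfl⟩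
  refine ⟨Sum.inr e, ⟨?_, ?_, ?_⟩, rfl⟩
  · rintro _ ⟨⟩; exact hin e rfl
  · simp [chanHead]
  · rintro _ ⟨⟩; simpa using N.tail_ne_head e

theorem sinkFailureProb_eq [Fintype F] (t : N.V) :
    N.sinkFailureProb F t =
      1 - (Nat.card {k : N.Coeffs F | w ≤ (N.decodingMatrix k t).rank} : ℝ) /
        Nat.card (N.Coeffs F) := by
  let _ : MeasurableSpace F := ⊤
  let _ : Fintype N.AdjPair := Fintype.ofFinite _
  have h1 := pi_uniformOfFintype_real {k : N.Coeffs F | (N.decodingMatrix k t).rank < w}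
  rw [sinkFailureProb]
  refine h1.trans ?_
  have h2 : {k : N.Coeffs F | (N.decodingMatrix k t).rank < w} =
      {k : N.Coeffs F | w ≤ (N.decodingMatrix k t).rank}ᶜ := by
    ext k; simp
  have h3 := Set.ncard_add_ncard_compl {k : N.Coeffs F | w ≤ (N.decodingMatrix k t).rank}
  have h4 : (Nat.card (N.Coeffs F) : ℝ) ≠ 0 := by exact_mod_cast Nat.card_pos.ne'
  rw [h2, Nat.card_coe_set_eq, Nat.card_coe_set_eq, eq_sub_iff_add_eq, ← add_div,
    div_eq_one_iff_eq h4, add_comm]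
  exact_mod_cast h3

theorem isUpstreamClosed_compl_singleton (ht : t ∈ N.T) :
    N.IsUpstreamClosed ({t}ᶜ : Set N.V) := by
  rintro e _ rfl
  exact N.sink_out e ht

open Classical in
theorem sinkFailureProb_le_of_flow [Fintype F] (ht : t ∈ N.T)
    (hP : ∀ v, v ≠ t → (N.flowIn P v).ncard = (N.flowOut P v).ncard) :
    N.sinkFailureProb F t ≤
      1 - ∏ v ∈ {t}ᶜ, invertibleProb (Fintype.card F) (N.flowOut P v).ncard := by
  have hcl := isUpstreamClosed_compl_singleton ht
  obtain ⟨h1, -, h2, -⟩ := card_goodCoeffs_bounds (F := F) hP {t}ᶜ (by simp)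
    (by rwa [Finset.coe_compl, Finset.coe_singleton])
  rw [Finset.coe_compl, Finset.coe_singleton] at h1 h2
  have h4 : (0 : ℝ) < Nat.card (N.Coeffs F) := by exact_mod_cast Nat.card_pos
  rw [sinkFailureProb_eq]
  refine sub_le_sub_left ((le_div_iff₀ h4).2 (h2.trans ?_)) _
  refine Nat.cast_le.2 (Nat.card_mono (Set.toFinite _) fun k hk => ?_)
  rw [goodCoeffs, Set.mem_ofPred_eq, linearIndepOn_iff_span_eq_top h1] at hk
  rw [Set.mem_ofPred_eq, le_rank_decodingMatrix_iff, eq_top_iff, ← hk]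
  exact Submodule.span_mono (flowCut_compl_singleton_image_subset ht k)

open Classical in
-- Here `hcl` makes the count of good coefficients exact, and `hin` makes goodness of the last cut
-- equivalent to full rank.
theorem sinkFailureProb_eq_of_flow [Fintype F] (ht : t ∈ N.T)
    (hP : ∀ v, v ≠ t → (N.flowIn P v).ncard = (N.flowOut P v).ncard)
    (hcl : ∀ e ∈ P, ∀ d, N.head d = N.tail e → d ∈ P) (hin : ∀ e, N.head e = t → e ∈ P) :
    N.sinkFailureProb F t =
      1 - ∏ v ∈ {t}ᶜ, invertibleProb (Fintype.card F) (N.flowOut P v).ncard := by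
  obtain ⟨h1, -, -, h2⟩ := card_goodCoeffs_bounds (F := F) hP {t}ᶜ (by simp)
    (by rw [Finset.coe_compl, Finset.coe_singleton]; exact isUpstreamClosed_compl_singleton ht)
  rw [Finset.coe_compl, Finset.coe_singleton] at h1 h2
  have h4 : (Nat.card (N.Coeffs F) : ℝ) ≠ 0 := by exact_mod_cast Nat.card_pos.ne'
  rw [sinkFailureProb_eq, eq_div_iff h4 |>.2 (h2 hcl)]
  have hset : N.goodCoeffs F P {t}ᶜ = {k | w ≤ (N.decodingMatrix k t).rank} := ?_
  · rw [hset]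
  ext k
  rw [goodCoeffs, Set.mem_ofPred_eq, linearIndepOn_iff_span_eq_top h1,
    Set.mem_ofPred_eq, le_rank_decodingMatrix_iff,
    (range_subset_flowCut_compl_singleton_image hin k).antisymm
      (flowCut_compl_singleton_image_subset ht k)]

theorem ncard_flowOut_le [Fintype F] (ht : t ∈ N.T)
    (hP : ∀ v, v ≠ t → (N.flowIn P v).ncard = (N.flowOut P v).ncard) {v : N.V} (hv : v ≠ t) :
    (N.flowOut P v).ncard ≤ w := by
  classical
  have hcl := isUpstreamClosed_compl_singleton ht
  exact (card_goodCoeffs_bounds (F := F) hP {t}ᶜ (by simp)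
    (by rwa [Finset.coe_compl, Finset.coe_singleton])).2.1 v (by simpa using hv)

open Classical in
-- The other sinks send nothing, so their factors are empty products.
theorem prod_compl_singleton_eq (ht : t ∈ N.T) (q : ℝ) :
    ∏ v ∈ {t}ᶜ, invertibleProb q (N.flowOut P v).ncard =
      ∏ v ∈ insert N.s N.J, invertibleProb q (N.flowOut P v).ncard := by
  symm
  apply Finset.prod_subset
  · intro v hv
    rw [Finset.mem_insert, J, Finset.mem_filter_univ] at hv
    rw [Finset.mem_compl, Finset.mem_singleton]
    rintro rfl
    rcases hv with rfl | hv
    · exact N.source_notMem ht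
    · exact hv.2 ht
  · intro v _ hv
    rw [Finset.mem_insert, J, Finset.mem_filter_univ] at hv
    have hvT : v ∈ N.T := by tauto
    have : N.flowOut P v = ∅ := by
      rw [Set.eq_empty_iff_forall_notMem]
      rintro e ⟨_, rfl⟩
      exact N.sink_out e hvT
    rw [this, Set.ncard_empty]
    simp [invertibleProb]

/-! ### The upper bound -/

open Classical in
theorem card_insert_source_J (N : CodingProblem w) : (insert N.s N.J).card = N.J.card + 1 :=
  Finset.card_insert_of_notMem (by simp [J])

theorem flowIn_eq_union (N : CodingProblem w) (P : Finset N.E) (v : N.V) : N.flowIn P v =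
    Sum.inl '' {_i : Fin w | N.s = v} ∪ Sum.inr '' {e : N.E | e ∈ P ∧ N.head e = v} := by
  ext d
  obtain i | e := d <;> simp [flowIn, flowChannels, chanHead]

open Classical in
-- The `w` imaginary channels balance the net outflow `w` of the source.
theorem ncard_flowIn_eq_of_netOut {v : N.V}
    (h : netOut N.tail N.head P v = if N.s = v then (w : ℤ) else 0) :
    (N.flowIn P v).ncard = (N.flowOut P v).ncard := by
  have h2 : Disjoint (Sum.inl '' {_i : Fin w | N.s = v} : Set N.Channel)
      (Sum.inr '' {e : N.E | e ∈ P ∧ N.head e = v}) := by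
    rw [Set.disjoint_left]
    rintro _ ⟨i, _, rfl⟩ ⟨e, _, h⟩
    cases h
  have h3 : ({_i : Fin w | N.s = v} : Set (Fin w)).ncard = if N.s = v then w else 0 := by
    split_ifs with h <;> simp [h]
  have h4 : ∀ f : N.E → N.V, ({e : N.E | e ∈ P ∧ f e = v} : Set N.E).ncard =
      ∑ e ∈ P, if f e = v then 1 else 0 := by
    intro f
    rw [Finset.sum_boole, ← Set.ncard_coe_finset]
    congr 1
    ext e; simp
  rw [flowIn_eq_union, Set.ncard_union_eq h2, Set.ncard_image_of_injective _ Sum.inl_injective,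
    Set.ncard_image_of_injective _ Sum.inr_injective, h3, flowOut, h4, h4]
  rw [netOut, Finset.sum_sub_distrib] at h
  zify
  rw [← h]
  ring

theorem sinkFailureProb_le [Fintype F] (ht : t ∈ N.T) :
    N.sinkFailureProb F t ≤ 1 - invertibleProb (Fintype.card F) w ^ (N.J.card + 1) := by
  classical
  have hq : (1 : ℝ) ≤ Fintype.card F := by exact_mod_cast Fintype.card_pos (α := F)
  obtain ⟨P, hP⟩ := exists_flow_of_le_cut (tail := N.tail) (head := N.head) (s := N.s) (t := t)
    (w := w) fun U hs ht' => (N.rate_le t ht).trans (Nat.sInf_le ⟨U, hs, ht', rfl⟩)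
  have hP' : ∀ v, v ≠ t → (N.flowIn P v).ncard = (N.flowOut P v).ncard :=
    fun v hv => ncard_flowIn_eq_of_netOut (hP v hv)
  refine (sinkFailureProb_le_of_flow ht hP').trans (sub_le_sub_left ?_ _)
  rw [prod_compl_singleton_eq ht, ← card_insert_source_J, ← Finset.prod_const]
  refine Finset.prod_le_prod (fun v _ => invertibleProb_nonneg hq w) fun v hv => ?_
  refine invertibleProb_anti hq (ncard_flowOut_le (F := F) ht hP' ?_)
  rintro rfl
  rw [Finset.mem_insert, J, Finset.mem_filter_univ] at hv
  rcases hv with rfl | hv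
  · exact N.source_notMem ht
  · exact hv.2 ht

/-! ### The extremal path network -/

open Classical in
theorem card_J_add_card_T (N : CodingProblem w) : N.J.card + N.T.card + 1 = Fintype.card N.V := by
  have h : insert N.s N.J = N.Tᶜ := by
    ext v
    have := N.source_notMem
    rw [Finset.mem_insert, J, Finset.mem_filter_univ, Finset.mem_compl]
    constructor
    · rintro (rfl | h)
      · exact this
      · exact h.2
    · tauto
  have h1 := N.card_insert_source_J
  rw [h] at h1
  have h2 := Finset.card_compl_add_card N.T
  omega

/-- If the network is a path of `w`-fold channels through all nodes outside `T`, followed by a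
`w`-fold channel from its end to each sink, the failure probability is maximal. Nodes are
numbered by `ν` and the channel groups by `κ`. -/
theorem sinkFailureProb_eq_of_numbering [Fintype F] {m : ℕ} (ht : t ∈ N.T) (hJ : N.J.card = m)
    (ν : N.V → ℕ) (hν : Function.Injective ν) (κ : N.E → ℕ) (hs : ν N.s = 0)
    (hT : ∀ v, v ∈ N.T ↔ m < ν v) (htail : ∀ e, ν (N.tail e) = min (κ e) m)
    (hhead : ∀ e, ν (N.head e) = κ e + 1)
    (hκ : ∀ i, i < m ∨ i + 1 = ν t → {e | κ e = i}.ncard = w) :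
    N.sinkFailureProb F t = 1 - invertibleProb (Fintype.card F) w ^ (m + 1) := by
  classical
  have hm : m < ν t := (hT t).1 ht
  -- The flow consists of the whole path and the one channel group entering `t`.
  let P : Finset N.E := Finset.univ.filter fun e => κ e < m ∨ κ e + 1 = ν t
  have hPmem : ∀ e, e ∈ P ↔ κ e < m ∨ κ e + 1 = ν t := fun e => Finset.mem_filter_univ e
  have htail' : ∀ e v, N.tail e = v ↔ min (κ e) m = ν v := fun e v => by
    rw [← htail, hν.eq_iff]
  have hhead' : ∀ e v, N.head e = v ↔ κ e + 1 = ν v := fun e v => by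
    rw [← hhead, hν.eq_iff]
  have hout : ∀ v, ν v ≤ m → (N.flowOut P v).ncard = w := by
    intro v hv
    by_cases h : ν v = m
    -- All groups `i ≥ m` leave node `m`; the one in `P` is number `ν t - 1`.
    · refine Eq.trans ?_ (hκ (ν t - 1) (by omega))
      congr 1
      ext e
      rw [flowOut, Set.mem_ofPred_eq, Set.mem_ofPred_eq, hPmem, htail']
      omega
    · refine Eq.trans ?_ (hκ (ν v) (by omega))
      congr 1
      ext e
      rw [flowOut, Set.mem_ofPred_eq, Set.mem_ofPred_eq, hPmem, htail']
      omega
  have hcons : ∀ v, v ≠ t → (N.flowIn P v).ncard = (N.flowOut P v).ncard := by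
    intro v hvt
    have hvt' : ν v ≠ ν t := fun h => hvt (hν h)
    have hin := N.flowIn_eq_union P v
    by_cases hvm : ν v ≤ m
    · rw [hout v hvm, hin]
      by_cases h0 : ν v = 0
      · have h1 : N.s = v := hν (hs.trans h0.symm)
        have h2 : {e : N.E | e ∈ P ∧ N.head e = v} = ∅ := by
          rw [Set.eq_empty_iff_forall_notMem]
          rintro e ⟨_, h⟩
          rw [hhead'] at h
          omega
        rw [h2, Set.image_empty, Set.union_empty,
          Set.ncard_image_of_injective _ Sum.inl_injective]
        simp [h1]
      · have h1 : N.s ≠ v := by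
          rintro rfl
          exact h0 hs
        have h2 : {e : N.E | e ∈ P ∧ N.head e = v} = {e | κ e = ν v - 1} := by
          ext e
          rw [Set.mem_ofPred_eq, Set.mem_ofPred_eq, hPmem, hhead']
          omega
        have h3 : {_i : Fin w | N.s = v} = ∅ := by simp [h1]
        rw [h2, h3, Set.image_empty, Set.empty_union,
          Set.ncard_image_of_injective _ Sum.inr_injective]
        exact hκ _ (by omega)
    · have h1 : N.flowOut P v = ∅ := by
        rw [Set.eq_empty_iff_forall_notMem]
        rintro e ⟨_, he⟩
        rw [htail'] at he
        omega
      have h2 : {e : N.E | e ∈ P ∧ N.head e = v} = ∅ := by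
        rw [Set.eq_empty_iff_forall_notMem]
        rintro e ⟨h, h'⟩
        rw [hhead'] at h'
        rw [hPmem] at h
        omega
      have h3 : {_i : Fin w | N.s = v} = ∅ := by
        have : N.s ≠ v := by
          rintro rfl
          omega
        simp [this]
      rw [hin, h1, h2, h3]
      simp
  rw [sinkFailureProb_eq_of_flow ht hcons, prod_compl_singleton_eq ht,
    Finset.prod_congr rfl (g := fun _ => invertibleProb (Fintype.card F : ℝ) w),
    Finset.prod_const, card_insert_source_J, hJ]
  · intro v hv
    rw [hout v]
    rw [Finset.mem_insert, J, Finset.mem_filter_univ, hT] at hv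
    rcases hv with rfl | ⟨_, hv⟩
    · omega
    · exact not_lt.1 hv
  · intro e he d hd
    rw [hPmem] at he ⊢
    have h := hhead d
    rw [hd, htail] at h
    omega
  · intro e he
    rw [hPmem]
    exact .inr ((hhead' e t).1 he)

/-- Node `j + 1` has the single predecessor `min j m`. Going back from a node outside `U` to `0 ∈
U`, some step crosses the cut. -/
theorem exists_path_cut {m n : ℕ} (U : Set (Fin (m + n + 1))) (h0 : 0 ∈ U) :
    ∀ j, ∀ h : j < m + n + 1, ⟨j, h⟩ ∉ U →
      ∃ i : Fin (m + n), (⟨min i m, by omega⟩ : Fin (m + n + 1)) ∈ U ∧ i.succ ∉ U := by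
  intro j
  induction j using Nat.strong_induction_on with
  | _ j ih =>
    intro h hj
    obtain _ | j := j
    · exact absurd h0 hj
    by_cases hp : (⟨min j m, by omega⟩ : Fin (m + n + 1)) ∈ U
    · exact ⟨⟨j, by omega⟩, hp, hj⟩
    · exact ih (min j m) (by omega) (by omega) hp

/-- The path `0, 1, …, m` of `w`-fold channels, with the sinks `m + 1, …, m + l` attached to `m`
by `w`-fold channels. The channel `(i, c)` enters the node `i + 1`. -/
def pathNetwork (w m l : ℕ) : Network where
  V := Fin (m + l + 1)
  E := Fin (m + l) × Fin w
  tail e := ⟨min e.1 m, by omega⟩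
  head e := e.1.succ
  acyclic v h := by
    have : ∀ a b : Fin (m + l + 1), Relation.TransGen (fun a b => ∃ e : Fin (m + l) × Fin w,
        (⟨min e.1 m, by omega⟩ : Fin (m + l + 1)) = a ∧ e.1.succ = b) a b → a < b := by
      intro a b h
      induction h with
      | single h =>
        obtain ⟨e, rfl, rfl⟩ := h
        rw [Fin.lt_def, Fin.val_succ]
        dsimp only
        omega
      | tail _ h ih =>
        obtain ⟨e, rfl, rfl⟩ := h
        refine ih.trans ?_
        rw [Fin.lt_def, Fin.val_succ]
        dsimp only
        omega
    exact (this v v h).false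

theorem ncard_fst_val_eq {n i : ℕ} (hi : i < n) (w : ℕ) :
    ({e | e.1.val = i} : Set (Fin n × Fin w)).ncard = w := by
  have : ({e | e.1.val = i} : Set (Fin n × Fin w)) = (fun c => (⟨i, hi⟩, c)) '' Set.univ := by
    ext ⟨a, c⟩
    simp [Fin.ext_iff, eq_comm]
  rw [this, Set.ncard_image_of_injective _ (Prod.mk_right_injective _)]
  simp

theorem le_minCut_pathNetwork (w m l : ℕ) (t : Fin (m + l + 1)) (ht : t ≠ 0) :
    w ≤ (pathNetwork w m l).minCut (0 : Fin (m + l + 1)) t := by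
  -- A cut must be exhibited, since `sInf ∅ = 0` in `ℕ`.
  refine le_csInf ⟨_, ({t}ᶜ : Set (Fin (m + l + 1))), Ne.symm ht, fun h => h rfl, rfl⟩ ?_
  rintro _ ⟨U, h0, htU, rfl⟩
  obtain ⟨i, hi, hi'⟩ := exists_path_cut U h0 t.val t.isLt htU
  have hsub : ({e | e.1.val = i.val} : Set (Fin (m + l) × Fin w)) ⊆
      {e : (pathNetwork w m l).E | (pathNetwork w m l).tail e ∈ U ∧
        (pathNetwork w m l).head e ∉ U} := by
    rintro ⟨j, c⟩ h
    obtain rfl : j = i := Fin.ext h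
    exact ⟨hi, hi'⟩
  exact (ncard_fst_val_eq i.isLt w).ge.trans (Set.ncard_le_ncard hsub (Set.toFinite _))

/-- The coding problem on `pathNetwork` with source `0`. -/
def pathProblem (w m l : ℕ) : CodingProblem w where
  toNetwork := pathNetwork w m l
  s := (0 : Fin (m + l + 1))
  T := (Finset.univ.filter fun v : Fin (m + l + 1) => m < v.val)
  source_notMem := by
    intro h
    have := (Finset.mem_filter.1 h).2
    simp at this
  sink_out e h := by
    have : m < min e.1.val m := (Finset.mem_filter.1 h).2
    omega
  rate_le t ht := by
    refine le_minCut_pathNetwork w m l t ?_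
    rintro rfl
    have := (Finset.mem_filter.1 ht).2
    simp at this

theorem card_T_pathProblem (w m l : ℕ) : (pathProblem w m l).T.card = l := by
  change (Finset.univ.filter fun v : Fin (m + l + 1) => m < v.val).card = l
  rw [show (Finset.univ.filter fun v : Fin (m + l + 1) => m < v.val) =
    Finset.univ.image (fun j : Fin l => (⟨m + 1 + j, by omega⟩ : Fin (m + l + 1))) from ?_,
    Finset.card_image_of_injective]
  · simp
  · intro a b h
    simpa [Fin.ext_iff] using h
  · ext v
    simp only [Finset.mem_filter_univ, Finset.mem_image, Finset.mem_univ, true_and]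
    constructor
    · intro h
      exact ⟨⟨v - (m + 1), by omega⟩, by ext; simp; omega⟩
    · rintro ⟨j, rfl⟩
      simp; omega

theorem card_J_pathProblem (w m l : ℕ) : (pathProblem w m l).J.card = m := by
  have h1 := (pathProblem w m l).card_J_add_card_T
  have h2 : Fintype.card (pathProblem w m l).V = m + l + 1 := Fintype.card_fin _
  rw [card_T_pathProblem] at h1
  omega

theorem sinkFailureProb_pathProblem [Fintype F] (w m l : ℕ) (t : (pathProblem w m l).V)
    (ht : t ∈ (pathProblem w m l).T) :
    (pathProblem w m l).sinkFailureProb F t =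
      1 - invertibleProb (Fintype.card F) w ^ (m + 1) := by
  refine sinkFailureProb_eq_of_numbering ht (card_J_pathProblem w m l) Fin.val Fin.val_injective
    (fun e => e.1.val) rfl (fun v => Finset.mem_filter_univ v) (fun e => rfl) (fun e => rfl) ?_
  intro i hi
  have h1 : Fin.val t < m + l + 1 := Fin.isLt t
  have h2 : m < Fin.val t := (Finset.mem_filter_univ (p := fun v : Fin (m + l + 1) => m < v.val)
    t).1 ht
  exact ncard_fst_val_eq (by omega) w

end CodingProblem

theorem theorem10 {F : Type*} [Field F] [Fintype F] (w m l : ℕ) (hl : 1 ≤ l) :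
    IsGreatest
      {p : ℝ | ∃ N : CodingProblem w, N.J.card = m ∧ N.T.card = l ∧
        ∃ t ∈ N.T, p = N.sinkFailureProb F t}
      (1 - (∏ i ∈ Finset.Icc 1 w, (1 - 1 / (Fintype.card F : ℝ) ^ i)) ^ (m + 1)) := by
  constructor
  · have hT : (CodingProblem.pathProblem w m l).T.Nonempty := by
      rw [← Finset.card_pos, CodingProblem.card_T_pathProblem]
      exact hl
    obtain ⟨t, ht⟩ := hT
    exact ⟨_, CodingProblem.card_J_pathProblem w m l, CodingProblem.card_T_pathProblem w m l,
      t, ht, (CodingProblem.sinkFailureProb_pathProblem w m l t ht).symm⟩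
  · rintro p ⟨N, rfl, -, t, ht, rfl⟩
    exact CodingProblem.sinkFailureProb_le ht
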